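/- **Setting.** Let $p\ge 1$. A unit is $(X,Y(1),Y(0),T)\in\mathbb R^p\times\mathbb R\times\mathbb R\times\{0,1\}$ with law $P$; its individual treatment effect is $\Delta=Y(1)-Y(0)$, and $(X,Y,T)$ with $Y=TY(1)+(1-T)Y(0)$ is observed. Let $\mathcal P_{\mathrm{SI}}^{\mathrm{str}}$ be the class of all laws $P$ such that at least one coordinate of $X$ has an absolutely continuous law, $Y(1)$ and $Y(0)$ have continuous distribution functions, $(Y(1),Y(0))\perp T\mid X$, and $P(T=1\mid X)\in[c_P,1-c_P]$ almost surely for some $c_P>0$. A (possibly randomized) conformal meta-learner is given $n$ observed i.i.d. units, split into a training fold and a calibration fold $\mathcal I$. On the training fold it fits a pseudo-outcome $\varphi(x,y,t)$ that replaces $\Delta$, and a nonconformity score $V(x,\delta)$ (for example $|\delta-\hat\tau(x)|$), both measurable. With the pseudo scores $V_{\varphi,i}=V(X_i,\varphi(X_i,Y_i,T_i))$, $i\in\mathcal I$, the conformal pseudo-interval at level $1-\alpha$ is $$\widehat C_\varphi(x)=\{\delta\in\mathbb R: V(x,\delta)\le \hat q_{1-\alpha}\},$$ where $\hat q_{1-\alpha}$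 is the $\lceil(1-\alpha)(|\mathcal I|+1)\rceil$-th smallest of the $V_{\varphi,i}$, $i\in\mathcal I$, and $+\infty$ if this rank exceeds $|\mathcal I|$. Below, $\mathbb P_P$ and $\mathbb E_P$ are taken over the $n$ units, an independent new unit from $P$ with covariates $X$ and effect $\Delta$, and the internal randomness. The validity threshold $\alpha^*(P)$ is the largest $a\in[0,1]$ such that $\mathbb P_P(\Delta\notin\widehat C_\varphi(X))\le\alpha$ for every $\alpha\in(0,a)$. **Corollary.** Suppose that $\alpha^*(P)\ge\epsilon>0$ for all $P\in\mathcal P_{\mathrm{SI}}^{\mathrm{str}}$. Let $0<\alpha\le\epsilon$ with $\alpha<1$; in the boundary case $\alpha=\epsilon$ suppose also that the threshold is itself an admissible level whenever it equals $\epsilon$, i.e. $\mathbb P_P(\Delta\notin\widehat C_\varphi(X))\le\epsilon$ at level $1-\epsilon$ for every $P\in\mathcal P_{\mathrm{SI}}^{\mathrm{str}}$ with $\alpha^*(P)=\epsilon$. Then the conformal pseudo-interval $\widehat C_\varphi$ at level $1-\alpha$ satisfies $$\mathbb P_P\bigl(y\notin\widehat C_\varphi(X)\bigr)\le\alpha\qquad\text{for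 all }P\in\mathcal P_{\mathrm{SI}}^{\mathrm{str}}\text{ and all }y\in\mathbb R.$$ Consequently $\mathbb E_P[\mathrm{length}(\widehat C_\varphi(X))]=\infty$ for every $P\in\mathcal P_{\mathrm{SI}}^{\mathrm{str}}$, where length is Lebesgue measure, and in particular $$\sup_{P\in\mathcal P_{\mathrm{SI}}^{\mathrm{str}}}\mathbb E_P\bigl[\mathrm{length}(\widehat C_\varphi(X))\bigr]=\infty .$$ -/

import Mathlib

open MeasureTheory ProbabilityTheory

noncomputable section

namespace ITE

/-- Full data of one unit: `(X, Y(1), Y(0), T)`, with `X ∈ ℝ^p` and `T = true` for treated. -/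
abbrev Full (p : ℕ) : Type := (Fin p → ℝ) × ℝ × ℝ × Bool

/-- Observed data of one unit: `(X, Y, T)`. -/
abbrev Obs (p : ℕ) : Type := (Fin p → ℝ) × ℝ × Bool

namespace Full

variable {p : ℕ}

/-- The covariates `X`. -/
def cov (ω : Full p) : Fin p → ℝ := ω.1

/-- The potential outcome `Y(1)`. -/
def y1 (ω : Full p) : ℝ := ω.2.1

/-- The potential outcome `Y(0)`. -/
def y0 (ω : Full p) : ℝ := ω.2.2.1

/-- The treatment indicator `T`. -/
def treat (ω : Full p) : Bool := ω.2.2.2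

/-- The individual treatment effect `Δ = Y(1) - Y(0)`. -/
def effect (ω : Full p) : ℝ := ω.y1 - ω.y0

/-- The observed part `(X, Y, T)` of a unit, where `Y = T Y(1) + (1 - T) Y(0)`. -/
def observe (ω : Full p) : Obs p := (ω.cov, if ω.treat then ω.y1 else ω.y0, ω.treat)

theorem measurable_cov : Measurable (cov : Full p → Fin p → ℝ) := measurable_fst

end Full

/-- The class `𝓔`: at least one coordinate of `X` has an absolutely continuous law, and the laws
of `Y(1)` and of `Y(0)` are continuous (have no atoms, i.e. continuous cdfs).  `T` is binary by its type. -/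
def classE (p : ℕ) : Set (ProbabilityMeasure (Full p)) :=
  {P | (∃ j : Fin p, (P : Measure (Full p)).map (fun ω => ω.cov j) ≪ volume) ∧
    (∀ c : ℝ, (P : Measure (Full p)) {ω | ω.y1 = c} = 0) ∧
    (∀ c : ℝ, (P : Measure (Full p)) {ω | ω.y0 = c} = 0)}

/-- The `σ`-algebra generated by the covariates. -/
abbrev covSigma (p : ℕ) : MeasurableSpace (Full p) :=
  MeasurableSpace.comap (Full.cov : Full p → Fin p → ℝ) inferInstance

theorem covSigma_le (p : ℕ) : covSigma p ≤ (inferInstance : MeasurableSpace (Full p)) :=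
  Full.measurable_cov.comap_le

/-- The strong-ignorability class: members of `𝓔` under which `(Y(1), Y(0)) ⊥ T | X`. -/
def classSI (p : ℕ) : Set (ProbabilityMeasure (Full p)) :=
  {P | P ∈ classE p ∧
    CondIndepFun (covSigma p) (covSigma_le p) (fun ω : Full p => (ω.y1, ω.y0)) Full.treat
      (P : Measure (Full p))}

/-- The propensity score `e_P(X) = P(T = 1 | X)`, as a random variable. -/
def propensity {p : ℕ} (P : ProbabilityMeasure (Full p)) : Full p → ℝ :=
  (P : Measure (Full p))⟦{ω : Full p | ω.treat = true} | covSigma p⟧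

/-- The strong-overlap class: strong ignorability, and `e_P(X) ∈ [c, 1 - c]` almost surely for
some `c > 0` that may depend on `P`. -/
def classSIstr (p : ℕ) : Set (ProbabilityMeasure (Full p)) :=
  {P | P ∈ classSI p ∧
    ∃ c : ℝ, 0 < c ∧ ∀ᵐ ω ∂(P : Measure (Full p)), propensity P ω ∈ Set.Icc c (1 - c)}

/-- The split-conformal quantile at level `1 - α` of the scores `v i`, `i ∈ s`: the
`⌈(1 - α)(|s| + 1)⌉`-th smallest of them, and `+∞` if this rank exceeds `|s|`. -/
def conformalQuantile {ι : Type*} (s : Finset ι) (v : ι → ℝ) (α : ℝ) : EReal :=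
  sInf {q : EReal | (1 - α) * ((s.card : ℝ) + 1) ≤
    (((s.filter fun i => (v i : EReal) ≤ q).card : ℕ) : ℝ)}

/-- A (possibly randomized) conformal meta-learner on `n` observed units, with internal
randomness `u : U`.  The units are split into a calibration fold and its complement, the training
fold.  All nuisance estimates (propensity score, outcome regressions, the estimator `τ̂` of the
treatment effect) are fitted on the training fold, and enter through
* the pseudo-outcome `Ỹ = φ(X, Y, T)` that replaces the unobserved effect `Δ`, and
* the nonconformity score `V(x, δ)`, for instance `|δ - τ̂(x)|`. -/
structure ConformalMetaLearner (p n : ℕ) (U : Type*) [MeasurableSpace U] where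
  /-- the calibration fold -/
  calib : U → Finset (Fin n)
  /-- the pseudo-outcome `φ`, fitted on data `d`, evaluated at an observed unit -/
  pseudo : U → (Fin n → Obs p) → Obs p → ℝ
  /-- the nonconformity score `V`, fitted on data `d`, evaluated at `(x, δ)` -/
  score : U → (Fin n → Obs p) → (Fin p → ℝ) → ℝ → ℝ
  pseudo_train : ∀ u d d', (∀ i, i ∉ calib u → d i = d' i) → pseudo u d = pseudo u d'
  score_train : ∀ u d d', (∀ i, i ∉ calib u → d i = d' i) → score u d = score u d'
  measurable_calib : ∀ i, MeasurableSet {u | i ∈ calib u}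
  measurable_pseudo :
    Measurable fun z : U × (Fin n → Obs p) × Obs p => pseudo z.1 z.2.1 z.2.2
  measurable_score :
    Measurable fun z : U × (Fin n → Obs p) × (Fin p → ℝ) × ℝ =>
      score z.1 z.2.1 z.2.2.1 z.2.2.2

namespace ConformalMetaLearner

variable {p n : ℕ} {U : Type*} [MeasurableSpace U]

/-- The pseudo score `V_φ` of an observed unit: the score of its pseudo-outcome. -/
def pseudoScore (M : ConformalMetaLearner p n U) (u : U) (d : Fin n → Obs p) (o : Obs p) : ℝ :=
  M.score u d o.1 (M.pseudo u d o)

/-- The conformal pseudo-interval `Ĉ_φ(x)` at nominal level `1 - α`: all `δ` whose score is at most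
the conformal quantile of the pseudo scores of the calibration fold. -/
def pseudoInterval (M : ConformalMetaLearner p n U) (α : ℝ) (u : U) (d : Fin n → Obs p)
    (x : Fin p → ℝ) : Set ℝ :=
  {δ | (M.score u d x δ : EReal) ≤
    conformalQuantile (M.calib u) (fun i => M.pseudoScore u d (d i)) α}

/-- The joint law, for `n` i.i.d. units from `P`, an independent new unit from `P`, and the
independent internal randomness of law `ρ`. -/
def jointLaw (n : ℕ) (ρ : Measure U) (P : ProbabilityMeasure (Full p)) :
    Measure ((Fin n → Full p) × Full p × U) :=
  (Measure.pi fun _ : Fin n => (P : Measure (Full p))).prod ((P : Measure (Full p)).prod ρ)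

/-- `Ĉ_φ(X)` for the new unit, as a random set on the joint sample space; it only uses the observed
data of the `n` units, the covariates of the new unit and the internal randomness. -/
def randomInterval (M : ConformalMetaLearner p n U) (α : ℝ)
    (z : (Fin n → Full p) × Full p × U) : Set ℝ :=
  M.pseudoInterval α z.2.2 (fun i => (z.1 i).observe) z.2.1.cov

/-- `ℙ_P(y ∉ Ĉ_φ(X))` for a fixed real `y`. -/
def missProb (M : ConformalMetaLearner p n U) (ρ : Measure U) (P : ProbabilityMeasure (Full p))
    (α y : ℝ) : ENNReal :=
  jointLaw n ρ P {z | y ∉ M.randomInterval α z}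

/-- Validity at level `1 - α` under `P`: `ℙ_P(Δ ∉ Ĉ_φ(X)) ≤ α`. -/
def IsValidAt (M : ConformalMetaLearner p n U) (ρ : Measure U) (P : ProbabilityMeasure (Full p))
    (α : ℝ) : Prop :=
  jointLaw n ρ P {z | z.2.1.effect ∉ M.randomInterval α z} ≤ ENNReal.ofReal α

/-- The validity threshold `α*(P)`: the largest `a ∈ [0, 1]` such that `Ĉ_φ` is valid under `P` at
level `1 - α` for every `α ∈ (0, a)`. -/
def validityThreshold (M : ConformalMetaLearner p n U) (ρ : Measure U)
    (P : ProbabilityMeasure (Full p)) : ℝ :=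
  sSup {a : ℝ | 0 ≤ a ∧ a ≤ 1 ∧ ∀ α : ℝ, 0 < α → α < a → M.IsValidAt ρ P α}

/-- `𝔼_P[length(Ĉ_φ(X))]`. -/
def expectedLength (M : ConformalMetaLearner p n U) (ρ : Measure U)
    (P : ProbabilityMeasure (Full p)) (α : ℝ) : ENNReal :=
  ∫⁻ z, volume (M.randomInterval α z) ∂(jointLaw n ρ P)

end ConformalMetaLearner

end ITE

end

/-!
A deterministic treatment rule `t` reveals only one of the two potential outcomes, so the hidden one
can be moved to make the treatment effect identically `y` without changing the observed data.
Following `t` except with probability `δ` restores strong overlap, and the resulting law of the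
observed data still dominates `(1 - 2 δ)` times the one under `t`. Validity for the effect `y` thus
bounds the probability that the region misses `y`, in the limit `δ → 0`, for every deterministic
rule. A randomized assignment behaves, on `n` units, like a deterministic one: drawing a single
uniform variable per cell of a fine grid of the absolutely continuous covariate gives, conditionally
on the draws, a deterministic rule, and the `n` units eventually lie in distinct cells. Finally, a
random set that contains each real number with probability at least `1 - α > 0` has infinite
expected length, by Tonelli's theorem.
-/

namespace ITE

open Filter Set Topology Function ConformalMetaLearner
open scoped ENNReal unitInterval

section RandomSets

theorem lintegral_measure_section_eq_top {Z Y : Type*} [MeasurableSpace Z] [MeasurableSpace Y]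
    {μ : Measure Z} [IsProbabilityMeasure μ] {κ : Measure Y} [SFinite κ] (hκ : κ univ = ∞)
    {S : Set (Z × Y)} (hS : MeasurableSet S) {a : ℝ≥0∞} (ha : a < 1)
    (hmiss : ∀ y, μ {z | (z, y) ∉ S} ≤ a) :
    ∫⁻ z, κ {y | (z, y) ∈ S} ∂μ = ∞ := by
  have hcover (y : Y) : 1 - a ≤ μ ((fun z => (z, y)) ⁻¹' S) := by
    rw [tsub_le_iff_left, ← prob_add_prob_compl (μ := μ) (measurable_prodMk_right hS), add_comm]
    exact add_le_add_left (hmiss y) _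
  rw [← top_le_iff]
  calc ∞ = ∫⁻ _, (1 - a) ∂κ := by
        rw [lintegral_const, hκ, ENNReal.mul_top (tsub_pos_of_lt ha).ne']
    _ ≤ ∫⁻ y, μ ((fun z => (z, y)) ⁻¹' S) ∂κ := lintegral_mono hcover
    _ = ∫⁻ z, κ {y | (z, y) ∈ S} ∂μ := by
        rw [← Measure.prod_apply_symm hS, Measure.prod_apply hS]; rfl

end RandomSets

section Domination

theorem measure_smul_map_le_map_prod {W E Y : Type*} [MeasurableSpace W] [MeasurableSpace E]
    [MeasurableSpace Y] {ν : Measure W} {μ : Measure E} [SFinite μ] {f : W → Y}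
    (hf : Measurable f) {g : W × E → Y} (hg : Measurable g) {S : Set E}
    (hfg : ∀ w, ∀ u ∈ S, g (w, u) = f w) :
    μ S • ν.map f ≤ (ν.prod μ).map g := by
  refine Measure.le_iff.2 fun B hB => ?_
  rw [Measure.smul_apply, smul_eq_mul, Measure.map_apply hf hB, Measure.map_apply hg hB, mul_comm,
    ← Measure.prod_prod]
  exact measure_mono fun z hz => by simpa [hfg z.1 z.2 hz.2] using hz.1

theorem prod_smul_pi_le_pi {ι : Type*} [Fintype ι] {X : ι → Type*} [∀ i, MeasurableSpace (X i)]
    {μ ν : ∀ i, Measure (X i)} [∀ i, SigmaFinite (μ i)] {c : ι → ℝ≥0∞}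
    (h : ∀ i, c i • μ i ≤ ν i) :
    (∏ i, c i) • Measure.pi μ ≤ Measure.pi ν := by
  refine Measure.le_iff.2 fun s hs => ?_
  rw [Measure.pi_def ν, toMeasure_apply _ _ hs]
  refine OuterMeasure.le_pi.2 (fun B _ => ?_) s
  calc ((∏ i, c i) • Measure.pi μ) (univ.pi B) = ∏ i, (c i • μ i) (B i) := by
        simp only [Measure.smul_apply, smul_eq_mul, Measure.pi_pi, Finset.prod_mul_distrib]
    _ ≤ ∏ i, ν i (B i) := Finset.prod_le_prod' fun i _ => h i (B i)

end Domination

section Grid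

theorem ae_injective_pi {ι X : Type*} [Fintype ι] [MeasurableSpace X] [MeasurableEq X]
    (μ : Measure X) [IsProbabilityMeasure μ] [NullSingletonClass μ] :
    ∀ᵐ x ∂Measure.pi fun _ : ι => μ, Injective x := by
  have hpair (i j : ι) (hij : i ≠ j) : ∀ᵐ x ∂Measure.pi fun _ : ι => μ, x i ≠ x j := by
    have hindep : (fun x : ι → X => x i) ⟂ᵢ[Measure.pi fun _ : ι => μ] fun x => x j :=
      (iIndepFun_pi (X := fun _ => id) fun _ => aemeasurable_id).indepFun hij
    have hmeas : Measurable fun x : ι → X => (x i, x j) := by fun_prop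
    have hlaw : (Measure.pi fun _ : ι => μ).map (fun x => (x i, x j)) = μ.prod μ := by
      rw [(indepFun_iff_map_prod_eq_prod_map_map hmeas.fst.aemeasurable hmeas.snd.aemeasurable).1
        hindep]
      exact congrArg₂ Measure.prod (measurePreserving_eval (fun _ => μ) i).map_eq
        (measurePreserving_eval (fun _ => μ) j).map_eq
    have hdiag : (μ.prod μ) (diagonal X) = 0 :=
      (Measure.measure_prod_null measurableSet_diagonal).2 <| .of_forall fun x => by
        have hsection : Prod.mk x ⁻¹' diagonal X = {x} := by ext; simp [eq_comm]
        simp only [hsection, measure_singleton, Pi.zero_apply]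
    rw [← hlaw] at hdiag
    exact ae_of_ae_map hmeas.aemeasurable (measure_eq_zero_iff_ae_notMem.1 hdiag)
  simp only [injective_iff_pairwise_ne, Pairwise, onFun, ae_all_iff]
  exact hpair

theorem eventually_injective_floor_mul {ι K : Type*} [Finite ι] [Field K] [LinearOrder K]
    [IsStrictOrderedRing K] [FloorRing K] {x : ι → K} (hx : Injective x) :
    ∀ᶠ N : ℕ in atTop, Injective fun i => ⌊N * x i⌋ := by
  have hpair (i j : ι) (hij : i ≠ j) : ∀ᶠ N : ℕ in atTop, ⌊N * x i⌋ ≠ ⌊N * x j⌋ := by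
    have hpos : 0 < |x i - x j| := abs_pos.2 (sub_ne_zero.2 (hx.ne hij))
    filter_upwards [(tendsto_natCast_atTop_atTop.atTop_mul_const hpos).eventually_ge_atTop 1]
      with N hN hfloor
    have hlt := Int.abs_sub_lt_one_of_floor_eq_floor hfloor
    rw [← mul_sub, abs_mul, Nat.abs_cast] at hlt
    exact hN.not_gt hlt
  simp only [injective_iff_pairwise_ne, Pairwise, onFun, eventually_all]
  exact hpair

variable {ι W E : Type*} [Fintype ι] [MeasurableSpace W] [MeasurableSpace E]

theorem lintegral_pi_prod {ν : Measure W} [SigmaFinite ν] {μ : Measure E} [SigmaFinite μ]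
    {F : (ι → W × E) → ℝ≥0∞} (hF : Measurable F) :
    ∫⁻ z, F z ∂Measure.pi (fun _ : ι => ν.prod μ) =
      ∫⁻ w, ∫⁻ u, F (fun i => (w i, u i)) ∂Measure.pi (fun _ : ι => μ)
        ∂Measure.pi fun _ : ι => ν := by
  have hsplit := (measurePreserving_arrowProdEquivProdArrow W E ι (fun _ => ν) fun _ => μ).symm
  have hFsplit := (hF.comp hsplit.measurable).aemeasurable (μ := (Measure.pi fun _ : ι => ν).prod
    (Measure.pi fun _ : ι => μ))
  rw [← hsplit.lintegral_comp hF]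
  exact lintegral_prod _ hFsplit

theorem measurable_eval_uncurry {κ : Type*} [Countable κ] [MeasurableSpace κ]
    [MeasurableSingletonClass κ] : Measurable fun z : κ × (κ → E) => z.2 z.1 :=
  measurable_from_prod_countable_right fun k => measurable_pi_apply k

theorem lintegral_infinitePi_comp_injective {κ : Type*} {μ : Measure E} [IsProbabilityMeasure μ]
    {k : ι → κ} (hk : Injective k) {f : (ι → E) → ℝ≥0∞} (hf : Measurable f) :
    ∫⁻ ζ, f (fun i => ζ (k i)) ∂Measure.infinitePi (fun _ : κ => μ) =
      ∫⁻ u, f u ∂Measure.pi fun _ : ι => μ := by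
  rw [← Measure.infinitePi_eq_pi, ← Measure.map_infinitePi_infinitePi_of_inj (P := fun _ => μ) hk,
    lintegral_map hf (by fun_prop)]

/-- Randomizing once per cell of a fine grid gives a function of `x` for each outcome of the
randomization, and is indistinguishable from randomizing once per index as soon as the points
`x (w i)` lie in distinct cells. -/
theorem lintegral_pi_prod_le_of_forall_comp {ν : Measure W} [IsProbabilityMeasure ν]
    {μ : Measure E} [IsProbabilityMeasure μ] {x : W → ℝ} (hx : Measurable x)
    [NullSingletonClass (ν.map x)] {F : (ι → W × E) → ℝ≥0∞} (hF : Measurable F) {c : ℝ≥0∞}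
    (hc : ∀ φ : ℝ → E, Measurable φ →
      ∫⁻ w, F (fun i => (w i, φ (x (w i)))) ∂Measure.pi (fun _ : ι => ν) ≤ c) :
    ∫⁻ z, F z ∂Measure.pi (fun _ : ι => ν.prod μ) ≤ c := by
  let perCell (N : ℕ) (w : ι → W) : ℝ≥0∞ :=
    ∫⁻ ζ, F (fun i => (w i, ζ ⌊N * x (w i)⌋)) ∂Measure.infinitePi fun _ : ℤ => μ
  have hmeas (N : ℕ) : Measurable fun z : (ι → W) × (ℤ → E) =>
      F (fun i => (z.1 i, z.2 ⌊N * x (z.1 i)⌋)) :=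
    hF.comp <| measurable_pi_lambda _ fun i => Measurable.prodMk (by fun_prop) <|
      measurable_eval_uncurry.comp
        (f := fun z : (ι → W) × (ℤ → E) => (⌊N * x (z.1 i)⌋, z.2)) (by fun_prop)
  have hperCell (N : ℕ) : ∫⁻ w, perCell N w ∂Measure.pi (fun _ : ι => ν) ≤ c := by
    rw [lintegral_lintegral_swap (hmeas N).aemeasurable]
    refine (lintegral_mono fun ζ : ℤ → E => hc (fun r => ζ ⌊N * r⌋) ?_).trans_eq (by simp)
    exact measurable_eval_uncurry.comp (f := fun r : ℝ => (⌊N * r⌋, ζ)) (by fun_prop)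
  have hdistinct : ∀ᵐ w ∂Measure.pi fun _ : ι => ν, Injective fun i => x (w i) := by
    have : IsProbabilityMeasure (ν.map x) := Measure.isProbabilityMeasure_map hx.aemeasurable
    have hlaw := ae_injective_pi (ι := ι) (ν.map x)
    rw [← Measure.pi_map_pi fun _ => hx.aemeasurable] at hlaw
    exact ae_of_ae_map (by fun_prop : Measurable fun (w : ι → W) i => x (w i)).aemeasurable hlaw
  have hlim : ∀ᵐ w ∂Measure.pi fun _ : ι => ν,
      ∫⁻ u, F (fun i => (w i, u i)) ∂Measure.pi (fun _ : ι => μ) =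
        liminf (fun N => perCell N w) atTop := by
    filter_upwards [hdistinct] with w hw
    refine (Tendsto.liminf_eq (tendsto_const_nhds.congr' ?_)).symm
    filter_upwards [eventually_injective_floor_mul hw] with N hN
    exact (lintegral_infinitePi_comp_injective (μ := μ) hN
      (hF.comp (g := F) (f := fun u i => (w i, u i)) (by fun_prop))).symm
  rw [lintegral_pi_prod hF, lintegral_congr_ae hlim]
  calc ∫⁻ w, liminf (fun N => perCell N w) atTop ∂Measure.pi (fun _ : ι => ν)
      ≤ liminf (fun N => ∫⁻ w, perCell N w ∂Measure.pi fun _ : ι => ν) atTop :=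
        lintegral_liminf_le fun N => (hmeas N).lintegral_prod_right'
    _ ≤ c := liminf_le_of_frequently_le' (Frequently.of_forall hperCell)

end Grid

section ConditionalNoise

theorem exists_isMarkovKernel_eq_map {X E T : Type*} [MeasurableSpace X] [MeasurableSpace E]
    [MeasurableSpace T] (μ : Measure E) [IsProbabilityMeasure μ] {r : X → E → T}
    (hr : Measurable (uncurry r)) :
    ∃ κ : Kernel X T, IsMarkovKernel κ ∧ ∀ x, μ.map (r x) = κ x := by
  refine ⟨(Kernel.id ×ₖ Kernel.const X μ).map (uncurry r), Kernel.IsMarkovKernel.map _ hr,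
    fun x => ?_⟩
  rw [Kernel.map_apply _ hr, Kernel.prod_apply, Kernel.id_apply, Kernel.const_apply,
    Measure.dirac_prod, Measure.map_map hr measurable_prodMk_left]
  rfl

theorem map_prod_noise_eq_compProd {W E T : Type*} [MeasurableSpace W] [MeasurableSpace E]
    [MeasurableSpace T] {ν : Measure W} [SFinite ν] {μ : Measure E} [SFinite μ] {r : W → E → T}
    (hr : Measurable (uncurry r)) {κ : Kernel W T} [IsSFiniteKernel κ]
    (hκ : ∀ w, μ.map (r w) = κ w) :
    (ν.prod μ).map (fun z => (z.1, r z.1 z.2)) = ν ⊗ₘ κ := by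
  have hmap : Measurable fun z : W × E => (z.1, r z.1 z.2) := measurable_fst.prodMk hr
  ext B hB
  rw [Measure.map_apply hmap hB, Measure.prod_apply (hmap hB), Measure.compProd_apply hB]
  refine lintegral_congr fun w => ?_
  have hrw : Measurable (r w) := hr.comp measurable_prodMk_left
  rw [← hκ w, Measure.map_apply hrw (measurable_prodMk_left hB)]
  rfl

variable {Ω X G T : Type*} [MeasurableSpace Ω] [MeasurableSpace X] [MeasurableSpace G]
  [MeasurableSpace T] {μ : Measure Ω} [IsFiniteMeasure μ] {k : Ω → X} {g : Ω → G} {f : Ω → T}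

theorem map_eq_compProd_of_map_eq_compProd_prodMkRight (hk : Measurable k) (hg : Measurable g)
    (hf : Measurable f) {κ : Kernel X T} [IsMarkovKernel κ]
    (h : μ.map (fun ω => ((k ω, g ω), f ω)) =
      μ.map (fun ω => (k ω, g ω)) ⊗ₘ κ.prodMkRight G) :
    μ.map (fun ω => (k ω, f ω)) = μ.map k ⊗ₘ κ := by
  have hforget : Measurable fun q : (X × G) × T => (q.1.1, q.2) := by fun_prop
  have hkf : (fun ω => (k ω, f ω)) = (fun q : (X × G) × T => (q.1.1, q.2)) ∘
      fun ω => ((k ω, g ω), f ω) := rfl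
  ext B hB
  rw [hkf, ← Measure.map_map hforget ((hk.prodMk hg).prodMk hf), h,
    Measure.map_apply hforget hB, Measure.compProd_apply (hforget hB), Measure.compProd_apply hB,
    lintegral_map (Kernel.measurable_kernel_prodMk_left (hforget hB)) (hk.prodMk hg),
    lintegral_map (Kernel.measurable_kernel_prodMk_left hB) hk]
  rfl

variable [StandardBorelSpace Ω] [StandardBorelSpace G] [Nonempty G]
  [StandardBorelSpace T] [Nonempty T]

theorem condIndepFun_iff_exists_compProd (hk : Measurable k) (hg : Measurable g)
    (hf : Measurable f) :
    CondIndepFun (MeasurableSpace.comap k inferInstance) hk.comap_le g f μ ↔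
      ∃ κ : Kernel X T, IsMarkovKernel κ ∧ μ.map (fun ω => ((k ω, g ω), f ω)) =
        μ.map (fun ω => (k ω, g ω)) ⊗ₘ κ.prodMkRight G := by
  rw [condIndepFun_iff_condDistrib_prod_ae_eq_prodMkRight hf hg hk]
  refine ⟨fun h => ⟨condDistrib f k μ, inferInstance,
    (condDistrib_ae_eq_iff_measure_eq_compProd _ hf.aemeasurable _).1 h⟩, ?_⟩
  rintro ⟨κ, hκ, h⟩
  have hκf : condDistrib f k μ =ᵐ[μ.map k] κ :=
    (condDistrib_ae_eq_iff_measure_eq_compProd _ hf.aemeasurable _).2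
      (map_eq_compProd_of_map_eq_compProd_prodMkRight hk hg hf h)
  have hfst : (μ.map fun ω => (k ω, g ω)).map Prod.fst = μ.map k :=
    Measure.map_map measurable_fst (hk.prodMk hg)
  rw [← hfst] at hκf
  filter_upwards [(condDistrib_ae_eq_iff_measure_eq_compProd _ hf.aemeasurable _).2 h,
    ae_of_ae_map measurable_fst.aemeasurable hκf] with q hq hq'
  rw [hq, Kernel.prodMkRight_apply, Kernel.prodMkRight_apply, hq']

end ConditionalNoise

section Assignment

variable {p : ℕ}

/-- The triple `(X, Y(1), Y(0))` of a unit, without its treatment. -/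
abbrev Potential (p : ℕ) : Type := (Fin p → ℝ) × ℝ × ℝ

/-- The part `(X, Y(1), Y(0))` of a unit. -/
def Full.potential (ω : Full p) : Potential p := (ω.cov, ω.y1, ω.y0)

/-- The unit that results from giving treatment `b` to `(X, Y(1), Y(0))`. -/
def Potential.assign (w : Potential p) (b : Bool) : Full p := (w.1, w.2.1, w.2.2, b)

@[fun_prop]
theorem Full.measurable_potential : Measurable (Full.potential : Full p → Potential p) := by
  unfold Full.potential Full.cov Full.y1 Full.y0; fun_prop

@[fun_prop]
theorem Full.measurable_treat : Measurable (Full.treat : Full p → Bool) := by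
  unfold Full.treat; fun_prop

@[fun_prop]
theorem Full.measurable_effect : Measurable (Full.effect : Full p → ℝ) := by
  unfold Full.effect Full.y1 Full.y0; fun_prop

@[fun_prop]
theorem Full.measurable_observe : Measurable (Full.observe : Full p → Obs p) := by
  unfold Full.observe Full.y1 Full.y0
  exact Full.measurable_cov.prodMk <| (Measurable.ite
    (Full.measurable_treat (measurableSet_singleton true)) (by fun_prop) (by fun_prop)).prodMk
    Full.measurable_treat

@[fun_prop]
theorem Potential.measurable_assign {Z : Type*} [MeasurableSpace Z] {w : Z → Potential p}
    {b : Z → Bool} (hw : Measurable w) (hb : Measurable b) :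
    Measurable fun z => (w z).assign (b z) := by
  unfold Potential.assign; fun_prop

theorem measurable_assign_randomized {r : (Fin p → ℝ) → I → Bool} (hr : Measurable (uncurry r)) :
    Measurable fun z : Potential p × I => z.1.assign (r z.1.1 z.2) :=
  Potential.measurable_assign measurable_fst <|
    hr.comp (f := fun z : Potential p × I => (z.1.1, z.2)) (by fun_prop)

/-- The condition that defines `classE`, as a property of the law of `(X, Y(1), Y(0))`. -/
def ContinuousMarginals (ν : ProbabilityMeasure (Potential p)) : Prop :=
  (∃ j : Fin p, (ν : Measure (Potential p)).map (fun w => w.1 j) ≪ volume) ∧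
    (∀ c : ℝ, (ν : Measure (Potential p)) {w | w.2.1 = c} = 0) ∧
    ∀ c : ℝ, (ν : Measure (Potential p)) {w | w.2.2 = c} = 0

/-- The law of `(X, Y(1), Y(0))` under `P`. -/
noncomputable def potentialLaw (P : ProbabilityMeasure (Full p)) :
    ProbabilityMeasure (Potential p) :=
  P.map Full.measurable_potential.aemeasurable

theorem mem_classE_iff {P : ProbabilityMeasure (Full p)} :
    P ∈ classE p ↔ ContinuousMarginals (potentialLaw P) := by
  simp only [classE, ContinuousMarginals, potentialLaw, ProbabilityMeasure.toMeasure_map]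
  refine and_congr (exists_congr fun j => ?_) (and_congr (forall_congr' fun c => ?_)
    (forall_congr' fun c => ?_))
  · rw [Measure.map_map (by fun_prop) Full.measurable_potential]; rfl
  · rw [Measure.map_apply Full.measurable_potential
      (measurableSet_eq_fun (by fun_prop) (by fun_prop))]; rfl
  · rw [Measure.map_apply Full.measurable_potential
      (measurableSet_eq_fun (by fun_prop) (by fun_prop))]; rfl

/-- The law of a unit whose potential outcomes are drawn from `ν` and whose treatment is
`r X u` for an independent uniform `u`. -/
noncomputable def assignLaw (ν : ProbabilityMeasure (Potential p)) {r : (Fin p → ℝ) → I → Bool}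
    (hr : Measurable (uncurry r)) : ProbabilityMeasure (Full p) :=
  (ν.prod ⟨volume, inferInstance⟩).map (measurable_assign_randomized hr).aemeasurable

variable {ν : ProbabilityMeasure (Potential p)} {r : (Fin p → ℝ) → I → Bool}

theorem coe_assignLaw (hr : Measurable (uncurry r)) :
    (assignLaw ν hr : Measure (Full p)) =
      ((ν : Measure (Potential p)).prod volume).map fun z => z.1.assign (r z.1.1 z.2) :=
  rfl

theorem map_potential_assignLaw (hr : Measurable (uncurry r)) :
    (assignLaw ν hr : Measure (Full p)).map Full.potential = ν := by
  rw [coe_assignLaw, Measure.map_map Full.measurable_potential (measurable_assign_randomized hr)]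
  exact Measure.fst_prod

theorem potentialLaw_assignLaw (hr : Measurable (uncurry r)) :
    potentialLaw (assignLaw ν hr) = ν :=
  Subtype.ext (map_potential_assignLaw hr)

theorem map_cov_assignLaw (hr : Measurable (uncurry r)) :
    (assignLaw ν hr : Measure (Full p)).map Full.cov =
      (ν : Measure (Potential p)).map Prod.fst := by
  rw [← map_potential_assignLaw hr, Measure.map_map measurable_fst Full.measurable_potential]
  rfl

theorem map_potential_treat_assignLaw (hr : Measurable (uncurry r)) {κ : Kernel (Fin p → ℝ) Bool}
    [IsMarkovKernel κ] (hκ : ∀ x, volume.map (r x) = κ x) :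
    (assignLaw ν hr : Measure (Full p)).map (fun ω => (ω.potential, ω.treat)) =
      (assignLaw ν hr : Measure (Full p)).map Full.potential ⊗ₘ κ.prodMkRight (ℝ × ℝ) := by
  rw [map_potential_assignLaw, coe_assignLaw,
    Measure.map_map (by fun_prop) (measurable_assign_randomized hr)]
  exact map_prod_noise_eq_compProd (r := fun w : Potential p => r w.1)
    (hr.comp (f := fun z : Potential p × I => (z.1.1, z.2)) (by fun_prop)) fun w => hκ w.1

theorem assignLaw_mem_classSI (hν : ContinuousMarginals ν) (hr : Measurable (uncurry r)) :
    assignLaw ν hr ∈ classSI p := by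
  refine ⟨mem_classE_iff.2 (by rwa [potentialLaw_assignLaw]), ?_⟩
  obtain ⟨κ, hκ, hrκ⟩ := exists_isMarkovKernel_eq_map volume hr
  exact (condIndepFun_iff_exists_compProd Full.measurable_cov
    (measurable_snd.comp Full.measurable_potential) Full.measurable_treat).2
    ⟨κ, hκ, map_potential_treat_assignLaw hr hrκ⟩

theorem propensity_assignLaw (hr : Measurable (uncurry r)) :
    propensity (assignLaw ν hr) =ᵐ[(assignLaw ν hr : Measure (Full p))]
      fun ω => volume.real {u | r ω.cov u = true} := by
  obtain ⟨κ, hκ, hrκ⟩ := exists_isMarkovKernel_eq_map volume hr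
  have hcond : condDistrib Full.treat Full.cov (assignLaw ν hr : Measure (Full p))
      =ᵐ[(assignLaw ν hr : Measure (Full p)).map Full.cov] κ :=
    (condDistrib_ae_eq_iff_measure_eq_compProd _ Full.measurable_treat.aemeasurable _).2 <|
      map_eq_compProd_of_map_eq_compProd_prodMkRight Full.measurable_cov
        (measurable_snd.comp Full.measurable_potential) Full.measurable_treat
        (map_potential_treat_assignLaw hr hrκ)
  filter_upwards [condDistrib_ae_eq_condExp (μ := (assignLaw ν hr : Measure (Full p)))
      Full.measurable_cov Full.measurable_treat (measurableSet_singleton true),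
    ae_of_ae_map Full.measurable_cov.aemeasurable hcond] with ω hexp hω
  have hrω : Measurable (r ω.cov) := hr.comp measurable_prodMk_left
  calc propensity (assignLaw ν hr) ω = (κ ω.cov).real {true} := by rw [← hω]; exact hexp.symm
    _ = volume.real {u | r ω.cov u = true} := by
        rw [← hrκ, map_measureReal_apply hrω (measurableSet_singleton true)]; rfl

theorem assignLaw_mem_classSIstr (hν : ContinuousMarginals ν) (hr : Measurable (uncurry r))
    {c : ℝ} (hc : 0 < c) (hrc : ∀ x, volume.real {u | r x u = true} ∈ Icc c (1 - c)) :
    assignLaw ν hr ∈ classSIstr p := by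
  refine ⟨assignLaw_mem_classSI hν hr, c, hc, ?_⟩
  filter_upwards [propensity_assignLaw hr] with ω hω
  exact hω ▸ hrc ω.cov

theorem exists_eq_assignLaw {P : ProbabilityMeasure (Full p)} (hP : P ∈ classSI p) :
    ∃ (r : (Fin p → ℝ) → I → Bool) (hr : Measurable (uncurry r)),
      P = assignLaw (potentialLaw P) hr := by
  obtain ⟨κ, hκ, hPκ⟩ := (condIndepFun_iff_exists_compProd Full.measurable_cov
    (measurable_snd.comp Full.measurable_potential) Full.measurable_treat).1 hP.2
  obtain ⟨r, hr, hrκ⟩ := κ.exists_measurable_map_eq_unitInterval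
  refine ⟨r, hr, Subtype.ext ?_⟩
  have hlaw : (P : Measure (Full p)).map (fun ω => (ω.potential, ω.treat)) =
      (assignLaw (potentialLaw P) hr : Measure (Full p)).map
        fun ω => (ω.potential, ω.treat) := by
    rw [map_potential_treat_assignLaw hr hrκ, map_potential_assignLaw]
    exact hPκ
  have hassign : (fun q : Potential p × Bool => q.1.assign q.2) ∘
      (fun ω : Full p => (ω.potential, ω.treat)) = id := rfl
  have h := congrArg (Measure.map fun q : Potential p × Bool => q.1.assign q.2) hlaw
  rwa [Measure.map_map (by fun_prop) (by fun_prop), Measure.map_map (by fun_prop) (by fun_prop),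
    hassign, Measure.map_id, Measure.map_id] at h

end Assignment

section ConstantEffect

variable {p : ℕ} {t : (Fin p → ℝ) → Bool}

/-- Changes the outcome that is not selected by `t` so that the treatment effect is `y`. -/
noncomputable def constEffect (t : (Fin p → ℝ) → Bool) (y : ℝ) (w : Potential p) : Potential p :=
  if t w.1 then (w.1, w.2.1, w.2.1 - y) else (w.1, w.2.2 + y, w.2.2)

theorem measurable_constEffect (ht : Measurable t) (y : ℝ) : Measurable (constEffect t y) :=
  Measurable.ite ((ht.comp measurable_fst) (measurableSet_singleton true)) (by fun_prop)
    (by fun_prop)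

theorem constEffect_fst (y : ℝ) (w : Potential p) : (constEffect t y w).1 = w.1 := by
  unfold constEffect; split <;> rfl

theorem effect_assign_constEffect (y : ℝ) (w : Potential p) (b : Bool) :
    ((constEffect t y w).assign b).effect = y := by
  unfold constEffect Full.effect Full.y1 Full.y0 Potential.assign
  split <;> simp

theorem observe_assign_constEffect (y : ℝ) (w : Potential p) :
    ((constEffect t y w).assign (t w.1)).observe = (w.assign (t w.1)).observe := by
  unfold constEffect Full.observe Full.y1 Full.y0 Potential.assign Full.cov Full.treat
  split <;> simp_all

theorem ContinuousMarginals.map_constEffect {ν : ProbabilityMeasure (Potential p)}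
    (hν : ContinuousMarginals ν) (ht : Measurable t) (y : ℝ) :
    ContinuousMarginals (ν.map (measurable_constEffect ht y).aemeasurable) := by
  have hce := measurable_constEffect ht y
  obtain ⟨⟨j, hj⟩, h1, h0⟩ := hν
  simp only [ContinuousMarginals, ProbabilityMeasure.toMeasure_map]
  refine ⟨⟨j, ?_⟩, fun c => ?_, fun c => ?_⟩
  · have hcov : (fun w : Potential p => w.1 j) ∘ constEffect t y = fun w => w.1 j :=
      funext fun w => congrFun (constEffect_fst y w) j
    rwa [Measure.map_map (by fun_prop) hce, hcov]
  · rw [Measure.map_apply hce (measurableSet_eq_fun (by fun_prop) (by fun_prop))]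
    refine measure_mono_null (fun w hw => ?_) (measure_union_null (h1 c) (h0 (c - y)))
    simp only [constEffect, mem_preimage, mem_ofPred_eq] at hw
    split at hw
    · exact Or.inl hw
    · exact Or.inr (eq_sub_of_add_eq hw)
  · rw [Measure.map_apply hce (measurableSet_eq_fun (by fun_prop) (by fun_prop))]
    refine measure_mono_null (fun w hw => ?_) (measure_union_null (h1 (c + y)) (h0 c))
    simp only [constEffect, mem_preimage, mem_ofPred_eq] at hw
    split at hw
    · exact Or.inl (eq_add_of_sub_eq hw)
    · exact Or.inr hw

/-- The randomized treatment rule that follows `t` except with probability `δ`. -/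
noncomputable def noisyRule (t : (Fin p → ℝ) → Bool) (δ : I) (x : Fin p → ℝ) (u : I) : Bool :=
  decide (u ≤ if t x then unitInterval.symm δ else δ)

theorem measurable_noisyRule (ht : Measurable t) (δ : I) :
    Measurable (uncurry (noisyRule t δ)) := by
  have hlevel : Measurable fun x => if t x then unitInterval.symm δ else δ :=
    Measurable.ite (ht (measurableSet_singleton true)) measurable_const measurable_const
  refine measurable_to_bool ?_
  have htreat : uncurry (noisyRule t δ) ⁻¹' {true} =
      {z | z.2 ≤ if t z.1 then unitInterval.symm δ else δ} := ext fun _ => decide_eq_true_iff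
  rw [htreat]
  exact measurableSet_le measurable_snd (hlevel.comp measurable_fst)

theorem noisyRule_eq {δ u : I} (hu : u ∈ Ioc δ (unitInterval.symm δ)) (x : Fin p → ℝ) :
    noisyRule t δ x u = t x := by
  cases h : t x <;> simp [noisyRule, h, hu.1, hu.2]

theorem volume_noisyRule_mem_Icc {δ : I} (hδ : (δ : ℝ) ≤ 1 / 2) (x : Fin p → ℝ) :
    volume.real {u | noisyRule t δ x u = true} ∈ Icc (δ : ℝ) (1 - δ) := by
  have hvol (a : I) : volume.real {u : I | u ≤ a} = a := by
    have hIic : {u : I | u ≤ a} = Iic a := rfl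
    rw [hIic, measureReal_def, unitInterval.volume_Iic, ENNReal.toReal_ofReal a.2.1]
  simp only [noisyRule, decide_eq_true_eq, hvol]
  split <;> simp only [unitInterval.coe_symm_eq, mem_Icc] <;> constructor <;> linarith

theorem classSIstr_nonempty (hp : 0 < p) : (classSIstr p).Nonempty := by
  let unif : ProbabilityMeasure ℝ := ⟨volume.restrict (Icc 0 1), ⟨by simp⟩⟩
  let ν : ProbabilityMeasure (Potential p) :=
    (ProbabilityMeasure.pi fun _ => unif).prod (unif.prod unif)
  let fair : I := ⟨1 / 2, by norm_num, by norm_num⟩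
  have hac : (unif : Measure ℝ) ≪ volume := Measure.restrict_le_self.absolutelyContinuous
  have hatom (c : ℝ) : (unif : Measure ℝ) {c} = 0 := hac (measure_singleton c)
  have hX : MeasurePreserving (fun w : Potential p => w.1 ⟨0, hp⟩) ν unif :=
    (measurePreserving_eval (fun _ => (unif : Measure ℝ)) _).comp measurePreserving_fst
  have hY1 : MeasurePreserving (fun w : Potential p => w.2.1) ν unif :=
    measurePreserving_fst.comp measurePreserving_snd
  have hY0 : MeasurePreserving (fun w : Potential p => w.2.2) ν unif :=
    measurePreserving_snd.comp measurePreserving_snd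
  have hν : ContinuousMarginals ν :=
    ⟨⟨⟨0, hp⟩, hX.map_eq ▸ hac⟩,
      fun c => (hY1.measure_preimage (measurableSet_singleton c).nullMeasurableSet).trans (hatom c),
      fun c => (hY0.measure_preimage (measurableSet_singleton c).nullMeasurableSet).trans (hatom c)⟩
  exact ⟨_, assignLaw_mem_classSIstr hν (measurable_noisyRule (t := fun _ => true)
    measurable_const fair) (c := fair) (by norm_num [fair])
    (volume_noisyRule_mem_Icc le_rfl)⟩

end ConstantEffect

section PredictionRegions

variable {p n : ℕ} {U : Type*} [MeasurableSpace U]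

/-- The data that a prediction region may use: the observed units, the covariates of the new unit
and the internal randomness. -/
def visible (z : (Fin n → Full p) × Full p × U) : (Fin n → Obs p) × (Fin p → ℝ) × U :=
  (fun i => (z.1 i).observe, z.2.1.cov, z.2.2)

theorem measurable_visible : Measurable (visible : (Fin n → Full p) × Full p × U → _) := by
  have := Full.measurable_cov (p := p)
  unfold visible; fun_prop

/-- The conditional probability, given the observed units `d`, that the prediction region with
graph `S` misses `y` when the new covariates have law `μ`. -/
noncomputable def missWeight (ρ : Measure U) (μ : Measure (Fin p → ℝ))
    (S : Set (((Fin n → Obs p) × (Fin p → ℝ) × U) × ℝ)) (y : ℝ) (d : Fin n → Obs p) : ℝ≥0∞ :=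
  (μ.prod ρ) {q | ((d, q), y) ∉ S}

variable {ρ : Measure U} {S : Set (((Fin n → Obs p) × (Fin p → ℝ) × U) × ℝ)} {a : ℝ≥0∞}

theorem measurableSet_notMem_section (hS : MeasurableSet S) (y : ℝ) :
    MeasurableSet {v | (v, y) ∉ S} :=
  measurable_prodMk_right hS.compl

theorem measurable_missWeight [SFinite ρ] {μ : Measure (Fin p → ℝ)} [SFinite μ]
    (hS : MeasurableSet S) (y : ℝ) : Measurable (missWeight ρ μ S y) :=
  measurable_measure_prodMk_left (measurableSet_notMem_section hS y)

instance [IsProbabilityMeasure ρ] (P : ProbabilityMeasure (Full p)) :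
    IsProbabilityMeasure (jointLaw n ρ P) := by
  unfold jointLaw; infer_instance

theorem measurePreserving_visible [IsProbabilityMeasure ρ] (P : ProbabilityMeasure (Full p)) :
    MeasurePreserving visible (jointLaw n ρ P)
      ((Measure.pi fun _ => (P : Measure (Full p)).map Full.observe).prod
        (((P : Measure (Full p)).map Full.cov).prod ρ)) := by
  have hcov : MeasurePreserving Full.cov (P : Measure (Full p)) _ := ⟨Full.measurable_cov, rfl⟩
  have hobserve : MeasurePreserving Full.observe (P : Measure (Full p)) _ :=
    ⟨Full.measurable_observe, rfl⟩
  have := Measure.isProbabilityMeasure_map (μ := (P : Measure (Full p))) hcov.aemeasurable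
  have := Measure.isProbabilityMeasure_map (μ := (P : Measure (Full p))) hobserve.aemeasurable
  exact (measurePreserving_pi _ _ fun _ => hobserve).prod (hcov.prod (MeasurePreserving.id ρ))

theorem jointLaw_notMem_eq_lintegral_missWeight [IsProbabilityMeasure ρ]
    (P : ProbabilityMeasure (Full p)) (hS : MeasurableSet S) (y : ℝ) :
    jointLaw n ρ P {z | (visible z, y) ∉ S} =
      ∫⁻ d, missWeight ρ ((P : Measure (Full p)).map Full.cov) S y d
        ∂Measure.pi fun _ => (P : Measure (Full p)).map Full.observe := by
  have := Measure.isProbabilityMeasure_map (μ := (P : Measure (Full p)))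
    Full.measurable_cov.aemeasurable
  have hmiss := measurableSet_notMem_section hS y
  exact ((measurePreserving_visible P).measure_preimage hmiss.nullMeasurableSet).trans
    (Measure.prod_apply hmiss)

theorem jointLaw_notMem_eq_of_effect_eq {Q : ProbabilityMeasure (Full p)} [IsProbabilityMeasure ρ]
    {y : ℝ} (hQ : ∀ᵐ ω ∂(Q : Measure (Full p)), ω.effect = y) :
    jointLaw n ρ Q {z | (visible z, y) ∉ S} =
      jointLaw n ρ Q {z | (visible z, z.2.1.effect) ∉ S} := by
  have hnew : MeasurePreserving (fun z => z.2.1) (jointLaw n ρ Q) (Q : Measure (Full p)) :=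
    measurePreserving_fst.comp measurePreserving_snd
  refine measure_congr (eventuallyEq_set.2 ?_)
  filter_upwards [hnew.quasiMeasurePreserving.ae hQ] with z hz
  simp only [hz]

/-- The law of a unit that has constant effect `y`, and whose observed part agrees, except with
probability `2 δ`, with that of `w ∼ ν` under the deterministic treatment rule `t`. -/
noncomputable def constEffectLaw (ν : ProbabilityMeasure (Potential p)) {t : (Fin p → ℝ) → Bool}
    (ht : Measurable t) (δ : I) (y : ℝ) : ProbabilityMeasure (Full p) :=
  assignLaw (ν.map (measurable_constEffect ht y).aemeasurable) (measurable_noisyRule ht δ)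

variable {ν : ProbabilityMeasure (Potential p)} {t : (Fin p → ℝ) → Bool}

theorem constEffectLaw_mem_classSIstr (hν : ContinuousMarginals ν) (ht : Measurable t) {δ : I}
    (hδ : 0 < δ) (hδ' : (δ : ℝ) ≤ 1 / 2) (y : ℝ) : constEffectLaw ν ht δ y ∈ classSIstr p :=
  assignLaw_mem_classSIstr (hν.map_constEffect ht y) _ hδ (volume_noisyRule_mem_Icc hδ')

theorem measurable_constEffect_assign (ht : Measurable t) (δ : I) (y : ℝ) :
    Measurable fun z : Potential p × I =>
      (constEffect t y z.1).assign (noisyRule t δ z.1.1 z.2) :=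
  Potential.measurable_assign ((measurable_constEffect ht y).comp measurable_fst) <|
    (measurable_noisyRule ht δ).comp (f := fun z : Potential p × I => (z.1.1, z.2)) (by fun_prop)

theorem coe_constEffectLaw (ht : Measurable t) (δ : I) (y : ℝ) :
    (constEffectLaw ν ht δ y : Measure (Full p)) =
      ((ν : Measure (Potential p)).prod volume).map fun z =>
        (constEffect t y z.1).assign (noisyRule t δ z.1.1 z.2) := by
  have hce := measurable_constEffect ht y
  have hprod := Measure.map_prod_map (ν : Measure (Potential p)) (volume : Measure I) hce
    measurable_id
  rw [Measure.map_id] at hprod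
  rw [constEffectLaw, coe_assignLaw, ProbabilityMeasure.toMeasure_map, hprod,
    Measure.map_map (measurable_assign_randomized (measurable_noisyRule ht δ))
      (hce.prodMap measurable_id)]
  simp only [comp_def, Prod.map_fst, Prod.map_snd, id, constEffect_fst]

theorem ae_effect_constEffectLaw (ht : Measurable t) (δ : I) (y : ℝ) :
    ∀ᵐ ω ∂(constEffectLaw ν ht δ y : Measure (Full p)), ω.effect = y := by
  rw [coe_constEffectLaw, ae_map_iff (measurable_constEffect_assign ht δ y).aemeasurable
    (measurableSet_eq_fun Full.measurable_effect measurable_const)]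
  exact .of_forall fun z => effect_assign_constEffect y z.1 _

theorem map_cov_constEffectLaw (ht : Measurable t) (δ : I) (y : ℝ) :
    (constEffectLaw ν ht δ y : Measure (Full p)).map Full.cov =
      (ν : Measure (Potential p)).map Prod.fst := by
  have hce := measurable_constEffect ht y
  have hfst : Prod.fst ∘ constEffect t y = Prod.fst := funext (constEffect_fst y)
  rw [constEffectLaw, map_cov_assignLaw, ProbabilityMeasure.toMeasure_map,
    Measure.map_map measurable_fst hce, hfst]

/-- The law of the observed part of a unit whose potential outcomes are drawn from `ν` and whose
treatment is `t X`, so that there is no overlap. -/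
noncomputable def observedLaw (ν : ProbabilityMeasure (Potential p)) (t : (Fin p → ℝ) → Bool) :
    Measure (Obs p) :=
  (ν : Measure (Potential p)).map fun w => (w.assign (t w.1)).observe

instance : IsFiniteMeasure (observedLaw ν t) := by
  unfold observedLaw; infer_instance

theorem measurable_observe_assign (ht : Measurable t) :
    Measurable fun w : Potential p => (w.assign (t w.1)).observe :=
  Full.measurable_observe.comp
    (Potential.measurable_assign measurable_id (ht.comp measurable_fst))

theorem smul_observedLaw_le_map_observe_constEffectLaw (ht : Measurable t) (δ : I) (y : ℝ) :
    ENNReal.ofReal (1 - 2 * δ) • observedLaw ν t ≤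
      (constEffectLaw ν ht δ y : Measure (Full p)).map Full.observe := by
  have hvol : volume (Ioc δ (unitInterval.symm δ)) = ENNReal.ofReal (1 - 2 * δ) := by
    rw [unitInterval.volume_Ioc, unitInterval.coe_symm_eq]; ring_nf
  have hnoisy := measurable_constEffect_assign ht δ y
  rw [coe_constEffectLaw, Measure.map_map Full.measurable_observe hnoisy, ← hvol]
  refine measure_smul_map_le_map_prod (measurable_observe_assign ht)
    (Full.measurable_observe.comp hnoisy) fun w u hu => ?_
  simp only [comp_apply, noisyRule_eq hu, observe_assign_constEffect]

theorem ofReal_pow_mul_lintegral_missWeight_le [IsProbabilityMeasure ρ] (hS : MeasurableSet S)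
    (hvalid : ∀ Q ∈ classSIstr p, jointLaw n ρ Q {z | (visible z, z.2.1.effect) ∉ S} ≤ a)
    (hν : ContinuousMarginals ν) (ht : Measurable t) (y : ℝ) {δ : I} (hδ : 0 < δ)
    (hδ' : (δ : ℝ) ≤ 1 / 2) :
    ENNReal.ofReal (1 - 2 * δ) ^ n *
      ∫⁻ d, missWeight ρ ((ν : Measure (Potential p)).map Prod.fst) S y d
        ∂Measure.pi (fun _ => observedLaw ν t) ≤ a := by
  calc _ = ∫⁻ d, missWeight ρ ((ν : Measure (Potential p)).map Prod.fst) S y d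
        ∂(∏ _ : Fin n, ENNReal.ofReal (1 - 2 * δ)) •
          Measure.pi (fun _ => observedLaw ν t) := by
        rw [lintegral_smul_measure, Finset.prod_const, Finset.card_fin, smul_eq_mul]
    _ ≤ ∫⁻ d, missWeight ρ ((ν : Measure (Potential p)).map Prod.fst) S y d
        ∂Measure.pi fun _ => (constEffectLaw ν ht δ y : Measure (Full p)).map Full.observe :=
        lintegral_mono' (prod_smul_pi_le_pi fun _ =>
          smul_observedLaw_le_map_observe_constEffectLaw ht δ y) le_rfl
    _ = jointLaw n ρ (constEffectLaw ν ht δ y) {z | (visible z, y) ∉ S} := by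
        rw [jointLaw_notMem_eq_lintegral_missWeight _ hS, map_cov_constEffectLaw]
    _ = jointLaw n ρ (constEffectLaw ν ht δ y) {z | (visible z, z.2.1.effect) ∉ S} :=
        jointLaw_notMem_eq_of_effect_eq (ae_effect_constEffectLaw ht δ y)
    _ ≤ a := hvalid _ (constEffectLaw_mem_classSIstr hν ht hδ hδ' y)

theorem lintegral_missWeight_le_of_rule [IsProbabilityMeasure ρ] (hS : MeasurableSet S)
    (hvalid : ∀ Q ∈ classSIstr p, jointLaw n ρ Q {z | (visible z, z.2.1.effect) ∉ S} ≤ a)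
    (hν : ContinuousMarginals ν) (ht : Measurable t) (y : ℝ) :
    ∫⁻ d, missWeight ρ ((ν : Measure (Potential p)).map Prod.fst) S y d
      ∂Measure.pi (fun _ => observedLaw ν t) ≤ a := by
  have hfactor : Tendsto (fun δ : I => ENNReal.ofReal (1 - 2 * δ) ^ n) (𝓝[>] 0) (𝓝 1) := by
    have hcont : Continuous fun δ : I => ENNReal.ofReal (1 - 2 * δ) ^ n :=
      (ENNReal.continuous_pow n).comp (ENNReal.continuous_ofReal.comp (by fun_prop))
    simpa using hcont.continuousWithinAt.tendsto (s := Ioi (0 : I)) (x := 0)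
  have hhalf : (0 : I) < ⟨1 / 2, by norm_num, by norm_num⟩ := by
    rw [← Subtype.coe_lt_coe]; norm_num
  have hlim := ENNReal.Tendsto.mul_const
    (b := ∫⁻ d, missWeight ρ ((ν : Measure (Potential p)).map Prod.fst) S y d
      ∂Measure.pi (fun _ => observedLaw ν t)) hfactor (.inl one_ne_zero)
  rw [one_mul] at hlim
  have := nhdsGT_neBot_of_exists_gt ⟨_, hhalf⟩
  refine le_of_tendsto hlim ?_
  filter_upwards [Ioc_mem_nhdsGT hhalf] with δ hδ
  exact ofReal_pow_mul_lintegral_missWeight_le hS hvalid hν ht y hδ.1 hδ.2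

theorem jointLaw_notMem_le_of_valid [IsProbabilityMeasure ρ] (hS : MeasurableSet S)
    (hvalid : ∀ Q ∈ classSIstr p, jointLaw n ρ Q {z | (visible z, z.2.1.effect) ∉ S} ≤ a)
    {P : ProbabilityMeasure (Full p)} (hP : P ∈ classSI p) (y : ℝ) :
    jointLaw n ρ P {z | (visible z, y) ∉ S} ≤ a := by
  obtain ⟨r, hr, hPr⟩ := exists_eq_assignLaw hP
  have hν := mem_classE_iff.1 hP.1
  obtain ⟨j, hj⟩ := hν.1
  set ν := potentialLaw P
  have : NullSingletonClass ((ν : Measure (Potential p)).map fun w => w.1 j) :=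
    ⟨fun c => hj (measure_singleton c)⟩
  have hassign := Full.measurable_observe.comp (measurable_assign_randomized hr)
  have hG := measurable_missWeight (ρ := ρ) (μ := (ν : Measure (Potential p)).map Prod.fst) hS y
  rw [jointLaw_notMem_eq_lintegral_missWeight P hS y, hPr, map_cov_assignLaw, coe_assignLaw,
    Measure.map_map Full.measurable_observe (measurable_assign_randomized hr),
    ← Measure.pi_map_pi fun _ => hassign.aemeasurable, lintegral_map hG (by fun_prop)]
  refine lintegral_pi_prod_le_of_forall_comp (x := fun w => w.1 j) (by fun_prop)
    (hG.comp (by fun_prop)) fun φ hφ => ?_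
  have ht : Measurable fun x : Fin p → ℝ => r x (φ (x j)) :=
    hr.comp (f := fun x : Fin p → ℝ => (x, φ (x j))) (by fun_prop)
  have hrule := lintegral_missWeight_le_of_rule hS hvalid hν ht y
  rwa [observedLaw, ← Measure.pi_map_pi fun _ => (measurable_observe_assign ht).aemeasurable,
    lintegral_map hG (by fun_prop)] at hrule

end PredictionRegions

section ConformalIntervals

variable {p n : ℕ} {U : Type*} [MeasurableSpace U]

theorem coe_le_conformalQuantile_iff {ι : Type*} (s : Finset ι) (v : ι → ℝ) (α x : ℝ) :
    (x : EReal) ≤ conformalQuantile s v α ↔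
      ((s.filter fun i => v i < x).card : ℝ) < (1 - α) * (s.card + 1) := by
  classical
  rw [← not_iff_not, not_le, not_lt, conformalQuantile, sInf_lt_iff]
  constructor
  · rintro ⟨q, hq, hqx⟩
    exact hq.trans <| Nat.cast_le.2 <| Finset.card_le_card <|
      Finset.monotone_filter_right s fun i _ hi => EReal.coe_lt_coe_iff.1 (hi.trans_lt hqx)
  · intro hrank
    refine ⟨(s.filter fun i => v i < x).sup fun i => (v i : EReal), hrank.trans <|
      Nat.cast_le.2 <| Finset.card_le_card fun i hi => ?_, ?_⟩
    · exact Finset.mem_filter.2 ⟨(Finset.mem_filter.1 hi).1,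
        Finset.le_sup (f := fun i => (v i : EReal)) hi⟩
    · exact (Finset.sup_lt_iff (EReal.bot_lt_coe x)).2 fun i hi =>
        EReal.coe_lt_coe_iff.2 (Finset.mem_filter.1 hi).2

theorem measurable_card_filter {Z ι : Type*} [MeasurableSpace Z] [Finite ι] {s : Z → Finset ι}
    (hs : ∀ i, MeasurableSet {z | i ∈ s z}) {q : Z → ι → Prop} [∀ z, DecidablePred (q z)]
    (hq : ∀ i, MeasurableSet {z | q z i}) :
    Measurable fun z => (((s z).filter (q z)).card : ℝ) := by
  classical
  have := Fintype.ofFinite ι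
  have hsum (z : Z) : (((s z).filter (q z)).card : ℝ) =
      ∑ i, {z | i ∈ s z ∧ q z i}.indicator (fun _ => (1 : ℝ)) z := by
    simp only [indicator, mem_ofPred_eq, Finset.sum_boole, ← Finset.filter_filter,
      Finset.filter_univ_mem]
  simp only [hsum]
  exact Finset.measurable_sum _ fun i _ => measurable_const.indicator ((hs i).inter (hq i))

namespace ConformalMetaLearner

theorem measurable_pseudoScore (M : ConformalMetaLearner p n U) :
    Measurable fun z : U × (Fin n → Obs p) × Obs p => M.pseudoScore z.1 z.2.1 z.2.2 := by
  have hpseudo := M.measurable_pseudo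
  exact M.measurable_score.comp (by fun_prop :
    Measurable fun z : U × (Fin n → Obs p) × Obs p =>
      (z.1, z.2.1, z.2.2.1, M.pseudo z.1 z.2.1 z.2.2))

theorem measurableSet_mem_pseudoInterval (M : ConformalMetaLearner p n U) (α : ℝ) :
    MeasurableSet {z : ((Fin n → Obs p) × (Fin p → ℝ) × U) × ℝ |
      z.2 ∈ M.pseudoInterval α z.1.2.2 z.1.1 z.1.2.1} := by
  classical
  have hcalib (i : Fin n) : MeasurableSet {z : ((Fin n → Obs p) × (Fin p → ℝ) × U) × ℝ |
      i ∈ M.calib z.1.2.2} :=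
    (by fun_prop : Measurable fun z : ((Fin n → Obs p) × (Fin p → ℝ) × U) × ℝ => z.1.2.2)
      (M.measurable_calib i)
  have hscore : Measurable fun z : ((Fin n → Obs p) × (Fin p → ℝ) × U) × ℝ =>
      M.score z.1.2.2 z.1.1 z.1.2.1 z.2 :=
    M.measurable_score.comp (f := fun z : ((Fin n → Obs p) × (Fin p → ℝ) × U) × ℝ =>
      (z.1.2.2, z.1.1, z.1.2.1, z.2)) (by fun_prop)
  have hpseudoScore (i : Fin n) : Measurable
      fun z : ((Fin n → Obs p) × (Fin p → ℝ) × U) × ℝ =>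
        M.pseudoScore z.1.2.2 z.1.1 (z.1.1 i) :=
    M.measurable_pseudoScore.comp (f := fun z : ((Fin n → Obs p) × (Fin p → ℝ) × U) × ℝ =>
      (z.1.2.2, z.1.1, z.1.1 i)) (by fun_prop)
  have hcard : Measurable fun z : ((Fin n → Obs p) × (Fin p → ℝ) × U) × ℝ =>
      ((M.calib z.1.2.2).card : ℝ) := by
    simpa using measurable_card_filter hcalib (q := fun _ _ => True) fun _ => .univ
  simp only [pseudoInterval, mem_ofPred_eq, coe_le_conformalQuantile_iff]
  exact measurableSet_lt (measurable_card_filter hcalib fun i =>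
    measurableSet_lt (hpseudoScore i) hscore) ((hcard.add_const 1).const_mul _)

theorem isValidAt_of_lt_validityThreshold {M : ConformalMetaLearner p n U} {ρ : Measure U}
    {P : ProbabilityMeasure (Full p)} {α : ℝ} (hα : 0 < α)
    (hαP : α < M.validityThreshold ρ P) : M.IsValidAt ρ P α := by
  have hzero : (0 : ℝ) ∈ {a : ℝ | 0 ≤ a ∧ a ≤ 1 ∧ ∀ α, 0 < α → α < a → M.IsValidAt ρ P α} :=
    ⟨le_rfl, zero_le_one, fun _ hpos hneg => absurd hneg hpos.not_gt⟩
  obtain ⟨b, ⟨-, -, hb⟩, hαb⟩ := exists_lt_of_lt_csSup ⟨0, hzero⟩ hαP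
  exact hb α hα hαb

end ConformalMetaLearner

end ConformalIntervals

end ITE

open ITE ConformalMetaLearner in
theorem mainTheorem6_general {p n : ℕ} (hp : 0 < p) {U : Type*} [MeasurableSpace U]
    (ρ : Measure U) [IsProbabilityMeasure ρ]
    {S : Set (((Fin n → Obs p) × (Fin p → ℝ) × U) × ℝ)} (hS : MeasurableSet S)
    {a : ENNReal} (ha : a < 1)
    (hvalid : ∀ Q ∈ classSIstr p, jointLaw n ρ Q {z | (visible z, z.2.1.effect) ∉ S} ≤ a) :
    (∀ P ∈ classSI p, ∀ y : ℝ, jointLaw n ρ P {z | (visible z, y) ∉ S} ≤ a) ∧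
    (∀ P ∈ classSI p, ∫⁻ z, volume {y | (visible z, y) ∈ S} ∂jointLaw n ρ P = ⊤) ∧
    (⨆ P ∈ classSIstr p, ∫⁻ z, volume {y | (visible z, y) ∈ S} ∂jointLaw n ρ P) = ⊤ := by
  have hmiss : ∀ P ∈ classSI p, ∀ y : ℝ, jointLaw n ρ P {z | (visible z, y) ∉ S} ≤ a :=
    fun P hP y => jointLaw_notMem_le_of_valid hS hvalid hP y
  have hgraph : MeasurableSet {w : ((Fin n → Full p) × Full p × U) × ℝ |
      (visible w.1, w.2) ∈ S} :=
    (measurable_visible.prodMap measurable_id) hS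
  have hlength : ∀ P ∈ classSI p,
      ∫⁻ z, volume {y | (visible z, y) ∈ S} ∂jointLaw n ρ P = ⊤ := fun P hP =>
    lintegral_measure_section_eq_top Real.volume_univ hgraph ha (hmiss P hP)
  obtain ⟨P, hP⟩ := classSIstr_nonempty hp
  exact ⟨hmiss, hlength, top_le_iff.1 ((hlength P hP.1).ge.trans (le_iSup₂ (f := fun P _ =>
    ∫⁻ z, volume {y | (visible z, y) ∈ S} ∂jointLaw n ρ P) P hP))⟩

theorem mainTheorem6 {p n : ℕ} (hp : 0 < p) {U : Type*} [MeasurableSpace U]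
    (ρ : MeasureTheory.Measure U) [MeasureTheory.IsProbabilityMeasure ρ]
    (M : ITE.ConformalMetaLearner p n U)
    (ε : ℝ) (hε : 0 < ε)
    (hthreshold : ∀ P ∈ ITE.classSIstr p, ε ≤ M.validityThreshold ρ P)
    (α : ℝ) (hα_pos : 0 < α) (hα_lt_one : α < 1) (hα_le : α ≤ ε)
    (hboundary : ∀ P ∈ ITE.classSIstr p, M.validityThreshold ρ P = α → M.IsValidAt ρ P α) :
    (∀ P ∈ ITE.classSIstr p, ∀ y : ℝ, M.missProb ρ P α y ≤ ENNReal.ofReal α) ∧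
    (∀ P ∈ ITE.classSIstr p, M.expectedLength ρ P α = ⊤) ∧
    (⨆ P ∈ ITE.classSIstr p, M.expectedLength ρ P α) = ⊤ := by
  have hvalid : ∀ Q ∈ ITE.classSIstr p, M.IsValidAt ρ Q α := fun Q hQ =>
    (hα_le.trans (hthreshold Q hQ)).lt_or_eq.elim
      (ITE.ConformalMetaLearner.isValidAt_of_lt_validityThreshold hα_pos)
      fun hα => hboundary Q hQ hα.symm
  obtain ⟨hmiss, hlength, hsup⟩ := mainTheorem6_general hp ρ
    (M.measurableSet_mem_pseudoInterval α) (ENNReal.ofReal_lt_one.2 hα_lt_one) hvalid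
  exact ⟨fun P hP => hmiss P hP.1, fun P hP => hlength P hP.1, hsup⟩
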